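/- For $a\ge 0$, $b>0$, $0<p<1$ and an integer $n\ge 0$, let $$\mathfrak C_n(a,b;p)=\frac{\sin(p\pi)}{\pi}\int_0^\infty\frac{t^p}{a^2+2a\cos(p\pi)\,t^p+t^{2p}}\,\frac{1}{(b+t)^{n+1}}\,dt$$ be the Catalan functional, and let $(x)_n=x(x+1)\cdots(x+n-1)$, $(x)_0=1$, be the rising factorial. The integral converges, and the following hold. (i) If $a>0$ and $|b^p/a|<1$, then $$\mathfrak C_n(a,b;p)=\frac{1}{a\,b^n\,n!}\sum_{k=0}^\infty(-pk)_n\Big(-\frac{b^p}{a}\Big)^{k},$$ and the series converges. (ii) If $a>0$ and $|b^p/a|>1$, then $$\mathfrak C_n(a,b;p)=-\frac{1}{a\,b^n\,n!}\sum_{k=1}^\infty(pk)_n\Big(-\frac{b^p}{a}\Big)^{-k},$$ and the series converges. If $n\ge1$, the summation may equally start at $k=0$, since $(0)_n=0$; if $n=0$, the term $k=0$ has to be omitted. For $a=0$ the formula holds after cancelling the factor $1/a$, that is, $\mathfrak C_n(0,b;p)=\dfrac{(p)_n}{n!\,b^{n+p}}$. (iii) If $a=b^p$, then $\mathfrak C_n(b^p,b;p)$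 is the limit of the right-hand side of (i), evaluated at $(a',b')$, as $(a',b')\to(b^p,b)$ within $\{a'>0,\ b'>0,\ |b'^p/a'|<1\}$, and also the limit of the right-hand side of (ii) (summed from $k=1$), evaluated at $(a',b')$, as $(a',b')\to(b^p,b)$ within $\{a'>0,\ b'>0,\ |b'^p/a'|>1\}$. (iv) For $n=0$ and all $a\ge 0$, $b>0$, $\mathfrak C_0(a,b;p)=\dfrac{1}{a+b^p}$; in particular $\mathfrak C_0(b^p,b;p)=\dfrac{1}{2b^p}$. -/

import Mathlib

open Filter Topology MeasureTheory

noncomputable section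

/-- The integrand `t^p / (a² + 2 a cos(pπ) t^p + t^{2p}) · (b + t)^{-(n+1)}`. -/
def catalanIntegrand (n : ℕ) (a b p t : ℝ) : ℝ :=
  t ^ p / (a ^ 2 + 2 * a * Real.cos (p * Real.pi) * t ^ p + t ^ (2 * p)) *
    (1 / (b + t) ^ (n + 1))

/-- The Catalan functional `𝔆_n(a,b;p)`. -/
def catalanFunctional (n : ℕ) (a b p : ℝ) : ℝ :=
  Real.sin (p * Real.pi) / Real.pi * ∫ t in Set.Ioi (0 : ℝ), catalanIntegrand n a b p t

/-- The rising factorial `(x)_n = x (x + 1) ⋯ (x + n - 1)`. -/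
def risingFactorial (x : ℝ) (n : ℕ) : ℝ := (ascPochhammer ℝ n).eval x

/-- The `k`-th term with the upper signs: `(-p k)_n (-b^p / a)^k`. -/
def upperTerm (n : ℕ) (a b p : ℝ) (k : ℕ) : ℝ :=
  risingFactorial (-(p * k)) n * (-(b ^ p / a)) ^ k

/-- The `k`-th term with the lower signs: `(p k)_n (-b^p / a)^{-k}`. -/
def lowerTerm (n : ℕ) (a b p : ℝ) (k : ℕ) : ℝ :=
  risingFactorial (p * k) n * (-(b ^ p / a)) ^ (-(k : ℤ))

end

/-! ### Bounds for the integrand and convergence of the integral. -/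

theorem sin_mul_pi_pos {p : ℝ} (hp0 : 0 < p) (hp1 : p < 1) : 0 < Real.sin (p * Real.pi) :=
  Real.sin_pos_of_pos_of_lt_pi (by positivity) (by nlinarith [Real.pi_pos])

/-- The difference of the two sides is the square `(a + x cos θ) ^ 2`. The bound is uniform in `a`,
hence so are all later dominations. -/
theorem sq_sin_mul_sq_le (a x θ : ℝ) :
    Real.sin θ ^ 2 * x ^ 2 ≤ a ^ 2 + 2 * a * Real.cos θ * x + x ^ 2 := by
  have h := Real.sin_sq_add_cos_sq θ
  have h2 : Real.sin θ ^ 2 * x ^ 2 = x ^ 2 - Real.cos θ ^ 2 * x ^ 2 := by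
    linear_combination x ^ 2 * h
  nlinarith [sq_nonneg (a + Real.cos θ * x)]

theorem rpow_two_mul_eq_sq {t : ℝ} (ht : 0 < t) (p : ℝ) : t ^ (2 * p) = (t ^ p) ^ 2 := by
  rw [mul_comm, Real.rpow_mul ht.le, Real.rpow_two]

theorem catalanDenom_pos {p : ℝ} (hp0 : 0 < p) (hp1 : p < 1) (a : ℝ) {t : ℝ} (ht : 0 < t) :
    0 < a ^ 2 + 2 * a * Real.cos (p * Real.pi) * t ^ p + t ^ (2 * p) := by
  rw [rpow_two_mul_eq_sq ht]
  refine lt_of_lt_of_le ?_ (sq_sin_mul_sq_le a (t ^ p) (p * Real.pi))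
  have := sin_mul_pi_pos hp0 hp1
  positivity

theorem catalanKernel_le {p : ℝ} (hp0 : 0 < p) (hp1 : p < 1) (a : ℝ) {t : ℝ} (ht : 0 < t) :
    t ^ p / (a ^ 2 + 2 * a * Real.cos (p * Real.pi) * t ^ p + t ^ (2 * p)) ≤
      1 / Real.sin (p * Real.pi) ^ 2 * t ^ (-p) := by
  have hs := sin_mul_pi_pos hp0 hp1
  have htp : 0 < t ^ p := Real.rpow_pos_of_pos ht p
  rw [div_le_iff₀ (catalanDenom_pos hp0 hp1 a ht), Real.rpow_neg ht.le, rpow_two_mul_eq_sq ht]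
  calc t ^ p = 1 / Real.sin (p * Real.pi) ^ 2 * (t ^ p)⁻¹ *
        (Real.sin (p * Real.pi) ^ 2 * (t ^ p) ^ 2) := by field_simp
    _ ≤ _ := by gcongr; exact sq_sin_mul_sq_le a (t ^ p) (p * Real.pi)

/-- The lower bound `c` for `b` makes the majorant locally uniform in `b`, as dominated convergence
requires. -/
theorem norm_catalanIntegrand_le {p : ℝ} (hp0 : 0 < p) (hp1 : p < 1) (n : ℕ) (a : ℝ) {b c t : ℝ}
    (hc : 0 < c) (hcb : c ≤ b) (ht : 0 < t) :
    ‖catalanIntegrand n a b p t‖ ≤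
      1 / Real.sin (p * Real.pi) ^ 2 * (t ^ (-p) * (1 / (c + t) ^ (n + 1))) := by
  have hD := catalanDenom_pos hp0 hp1 a ht
  have hb : 0 < b := hc.trans_le hcb
  rw [Real.norm_of_nonneg (by unfold catalanIntegrand; positivity), catalanIntegrand, ← mul_assoc]
  gcongr
  exact catalanKernel_le hp0 hp1 a ht

theorem integrableOn_rpow_neg_mul_inv_pow {p : ℝ} (hp0 : 0 < p) (hp1 : p < 1) (n : ℕ) {b : ℝ}
    (hb : 0 < b) :
    IntegrableOn (fun t : ℝ => t ^ (-p) * (1 / (b + t) ^ (n + 1))) (Set.Ioi 0) := by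
  have hmeas : Measurable (fun t : ℝ => t ^ (-p) * (1 / (b + t) ^ (n + 1))) := by fun_prop
  have hsplit : Set.Ioi (0 : ℝ) = Set.Ioc 0 1 ∪ Set.Ioi 1 :=
    (Set.Ioc_union_Ioi_eq_Ioi zero_le_one).symm
  rw [hsplit]
  refine IntegrableOn.union ?_ ?_
  · have h1 : IntegrableOn (fun t : ℝ => t ^ (-p)) (Set.Ioc 0 1) :=
      (intervalIntegrable_iff_integrableOn_Ioc_of_le zero_le_one).1
        (intervalIntegral.intervalIntegrable_rpow' (by linarith))
    refine Integrable.mono' (h1.mul_const (1 / b ^ (n + 1))) hmeas.aestronglyMeasurable ?_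
    filter_upwards [ae_restrict_mem measurableSet_Ioc] with t ht
    have ht0 : 0 < t := ht.1
    rw [Real.norm_of_nonneg (by positivity)]
    gcongr
    linarith
  · have h1 : IntegrableOn (fun t : ℝ => t ^ (-p - 1)) (Set.Ioi 1) :=
      integrableOn_Ioi_rpow_of_lt (by linarith) one_pos
    refine Integrable.mono' (h1.mul_const (1 / b ^ n * 1)) hmeas.aestronglyMeasurable ?_
    filter_upwards [ae_restrict_mem measurableSet_Ioi] with t ht
    have ht1 : 1 < t := ht
    have ht0 : 0 < t := by linarith
    rw [Real.norm_of_nonneg (by positivity), Real.rpow_sub_one ht0.ne', div_mul_eq_mul_div,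
      mul_div_assoc]
    gcongr ?_ * ?_
    -- Here `(b + t) ^ (n + 1) ≥ b ^ n * t`, so one factor supplies the decay at infinity.
    rw [mul_one, div_div, pow_succ]
    gcongr <;> linarith

theorem measurable_catalanIntegrand (n : ℕ) (a b p : ℝ) :
    Measurable (catalanIntegrand n a b p) := by
  unfold catalanIntegrand
  fun_prop

theorem integrableOn_catalanIntegrand {p : ℝ} (hp0 : 0 < p) (hp1 : p < 1) (n : ℕ) (a : ℝ) {b : ℝ}
    (hb : 0 < b) : IntegrableOn (catalanIntegrand n a b p) (Set.Ioi 0) := by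
  refine Integrable.mono' ((integrableOn_rpow_neg_mul_inv_pow hp0 hp1 n hb).const_mul
    (1 / Real.sin (p * Real.pi) ^ 2)) (measurable_catalanIntegrand n a b p).aestronglyMeasurable ?_
  filter_upwards [ae_restrict_mem measurableSet_Ioi] with t ht
  exact norm_catalanIntegrand_le hp0 hp1 n a hb le_rfl ht

/-! ### Dependence on the parameters `a` and `b`. -/

theorem hasDerivAt_catalanIntegrand (n : ℕ) (a p : ℝ) {b t : ℝ} (hbt : 0 < b + t) :
    HasDerivAt (fun b => catalanIntegrand n a b p t)
      (-((n : ℝ) + 1) * catalanIntegrand (n + 1) a b p t) b := by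
  unfold catalanIntegrand
  have h1 : HasDerivAt (fun b : ℝ => (b + t) ^ (n + 1)) (((n + 1 : ℕ) : ℝ) * (b + t) ^ n * 1) b :=
    ((hasDerivAt_id b).add_const t).pow (n + 1)
  have h2 := (h1.inv (pow_ne_zero _ hbt.ne')).const_mul
    (t ^ p / (a ^ 2 + 2 * a * Real.cos (p * Real.pi) * t ^ p + t ^ (2 * p)))
  simp only [one_div]
  refine h2.congr_deriv ?_
  push_cast
  have : b + t ≠ 0 := hbt.ne'
  rw [mul_left_comm]
  congr 1
  field_simp
  ring

theorem hasDerivAt_catalanFunctional {p : ℝ} (hp0 : 0 < p) (hp1 : p < 1) (n : ℕ) (a : ℝ) {b : ℝ}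
    (hb : 0 < b) :
    HasDerivAt (fun b => catalanFunctional n a b p)
      (-((n : ℝ) + 1) * catalanFunctional (n + 1) a b p) b := by
  have key := (hasDerivAt_integral_of_dominated_loc_of_deriv_le
    (μ := volume.restrict (Set.Ioi (0 : ℝ))) (s := Set.Ioi (b / 2)) (x₀ := b)
    (F := fun b t => catalanIntegrand n a b p t)
    (F' := fun b t => -((n : ℝ) + 1) * catalanIntegrand (n + 1) a b p t)
    (bound := fun t => ((n : ℝ) + 1) * (1 / Real.sin (p * Real.pi) ^ 2 *
      (t ^ (-p) * (1 / (b / 2 + t) ^ (n + 1 + 1)))))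
    (Ioi_mem_nhds (by linarith))
    (Eventually.of_forall fun b => (measurable_catalanIntegrand n a b p).aestronglyMeasurable)
    (integrableOn_catalanIntegrand hp0 hp1 n a hb)
    ((measurable_catalanIntegrand (n + 1) a b p).const_mul _).aestronglyMeasurable
    ?_ (((integrableOn_rpow_neg_mul_inv_pow hp0 hp1 (n + 1) (half_pos hb)).const_mul _).const_mul _)
    ?_).2
  · have := key.const_mul (Real.sin (p * Real.pi) / Real.pi)
    rw [integral_const_mul, mul_left_comm] at this
    exact this
  · filter_upwards [ae_restrict_mem measurableSet_Ioi] with t ht x hx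
    rw [norm_mul, norm_neg, Real.norm_of_nonneg (by positivity : (0 : ℝ) ≤ n + 1)]
    gcongr
    exact norm_catalanIntegrand_le hp0 hp1 (n + 1) a (half_pos hb) (le_of_lt hx) ht
  · filter_upwards [ae_restrict_mem measurableSet_Ioi] with t ht x hx
    refine hasDerivAt_catalanIntegrand n a p ?_
    have h1 : 0 < t := ht
    have h2 : b / 2 < x := hx
    linarith

theorem continuousAt_catalanFunctional {p : ℝ} (hp0 : 0 < p) (hp1 : p < 1) (n : ℕ) (a : ℝ) {b : ℝ}
    (hb : 0 < b) :
    ContinuousAt (fun q : ℝ × ℝ => catalanFunctional n q.1 q.2 p) (a, b) := by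
  refine ContinuousAt.mul continuousAt_const ?_
  refine continuousAt_of_dominated
    (bound := fun t => 1 / Real.sin (p * Real.pi) ^ 2 *
      (t ^ (-p) * (1 / (b / 2 + t) ^ (n + 1))))
    (Eventually.of_forall fun q => (measurable_catalanIntegrand n q.1 q.2 p).aestronglyMeasurable)
    ?_ ((integrableOn_rpow_neg_mul_inv_pow hp0 hp1 n (half_pos hb)).const_mul _) ?_
  · have hev : ∀ᶠ q : ℝ × ℝ in 𝓝 (a, b), b / 2 < q.2 :=
      continuousAt_snd.eventually (Ioi_mem_nhds (by simpa using hb))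
    filter_upwards [hev] with q hq
    filter_upwards [ae_restrict_mem measurableSet_Ioi] with t ht
    exact norm_catalanIntegrand_le hp0 hp1 n q.1 (half_pos hb) hq.le ht
  · filter_upwards [ae_restrict_mem measurableSet_Ioi] with t ht
    have h0 : 0 < t := ht
    have hD := (catalanDenom_pos hp0 hp1 a h0).ne'
    have hbt : (b + t) ^ (n + 1) ≠ 0 := by positivity
    unfold catalanIntegrand
    refine ContinuousAt.mul (ContinuousAt.div (by fun_prop) (by fun_prop) hD)
      (ContinuousAt.div (by fun_prop) (by fun_prop) hbt)

/-! ### The contour integral over the strip `0 ≤ Im w ≤ π`. -/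

/-- For `a ≥ 0` the modulus decreases as `Im w` grows, since cosine decreases on `[0, π]`; the worst
case `Im w = π` is `sq_sin_mul_sq_le`. -/
theorem sin_mul_exp_le_norm_add_exp {p : ℝ} (hp0 : 0 < p) (hp1 : p < 1) {a : ℝ} (ha : 0 ≤ a)
    {w : ℂ} (h0 : 0 ≤ w.im) (h1 : w.im ≤ Real.pi) :
    Real.sin (p * Real.pi) * Real.exp (p * w.re) ≤ ‖(a : ℂ) + Complex.exp (p * w)‖ := by
  have hs := sin_mul_pi_pos hp0 hp1
  have hpi := Real.pi_pos
  have hcos : Real.cos (p * Real.pi) ≤ Real.cos (p * w.im) :=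
    Real.cos_le_cos_of_nonneg_of_le_pi (by positivity) (by nlinarith) (by gcongr)
  refine le_of_sq_le_sq ?_ (norm_nonneg _)
  rw [← Complex.normSq_eq_norm_sq, Complex.normSq_apply]
  simp only [Complex.add_re, Complex.add_im, Complex.ofReal_re, Complex.ofReal_im,
    Complex.exp_re, Complex.exp_im, Complex.re_ofReal_mul, Complex.im_ofReal_mul]
  set X := Real.exp (p * w.re)
  have hX : 0 < X := Real.exp_pos _
  have h2 := sq_sin_mul_sq_le a X (p * Real.pi)
  have h3 : 2 * a * Real.cos (p * Real.pi) * X ≤ 2 * a * Real.cos (p * w.im) * X := by gcongr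
  have h4 := Real.sin_sq_add_cos_sq (p * w.im)
  have h5 : (0 + X * Real.sin (p * w.im)) * (0 + X * Real.sin (p * w.im)) =
    X ^ 2 - X ^ 2 * Real.cos (p * w.im) ^ 2 := by linear_combination X ^ 2 * h4
  rw [h5]
  nlinarith

theorem add_exp_ne_zero {p : ℝ} (hp0 : 0 < p) (hp1 : p < 1) {a : ℝ} (ha : 0 ≤ a)
    {w : ℂ} (h0 : 0 ≤ w.im) (h1 : w.im ≤ Real.pi) : (a : ℂ) + Complex.exp (p * w) ≠ 0 := by
  rw [← norm_pos_iff]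
  exact (mul_pos (sin_mul_pi_pos hp0 hp1) (Real.exp_pos _)).trans_le
    (sin_mul_exp_le_norm_add_exp hp0 hp1 ha h0 h1)

/-- `1 / (a + e ^ (p w))` minus the multiple of `e ^ (-w / 2)` that makes it vanish at `w = l`. -/
noncomputable def stieltjesNum (a p l : ℝ) (w : ℂ) : ℂ :=
  1 / ((a : ℂ) + Complex.exp (p * w)) -
    (Real.exp (l / 2) / (a + Real.exp (p * l)) : ℝ) * Complex.exp (-w / 2)

/-- The holomorphic extension of `stieltjesNum a p l w * e ^ w / (e ^ w - e ^ l)` to `w = l`. -/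
noncomputable def stieltjesFun (a p l : ℝ) (w : ℂ) : ℂ :=
  dslope (stieltjesNum a p l) l w / dslope Complex.exp l w * Complex.exp w

theorem stieltjesNum_self {a : ℝ} (ha : 0 ≤ a) (p l : ℝ) : stieltjesNum a p l l = 0 := by
  have h : a + Real.exp (p * l) ≠ 0 := by positivity
  have h2 : stieltjesNum a p l l = ((1 / (a + Real.exp (p * l)) -
      Real.exp (l / 2) / (a + Real.exp (p * l)) * Real.exp (-l / 2) : ℝ) : ℂ) := by
    simp [stieltjesNum]
  rw [h2, div_mul_eq_mul_div, ← Real.exp_add]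
  simp [show l / 2 + -l / 2 = 0 by ring]

theorem stieltjesFun_of_ne {a : ℝ} (ha : 0 ≤ a) (p : ℝ) {l : ℝ} {w : ℂ} (hw : w ≠ l) :
    stieltjesFun a p l w =
      stieltjesNum a p l w * (Complex.exp w / (Complex.exp w - Real.exp l)) := by
  have h : w - l ≠ 0 := sub_ne_zero.2 hw
  rw [stieltjesFun, dslope_of_ne _ hw, dslope_of_ne _ hw, slope_def_field, slope_def_field,
    stieltjesNum_self ha, sub_zero, div_div_div_cancel_right₀ h, Complex.ofReal_exp]
  ring

/-- The exponential is injective on the strip and its derivative never vanishes. -/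
theorem dslope_exp_ne_zero (l : ℝ) {w : ℂ} (h0 : 0 ≤ w.im) (h1 : w.im ≤ Real.pi) :
    dslope Complex.exp l w ≠ 0 := by
  by_cases hw : w = l
  · rw [hw, dslope_same, Complex.deriv_exp]
    exact Complex.exp_ne_zero _
  · rw [dslope_of_ne _ hw, slope_def_field]
    refine div_ne_zero (sub_ne_zero.2 fun h => hw ?_) (sub_ne_zero.2 hw)
    have := Real.pi_pos
    exact Complex.exp_inj_of_neg_pi_lt_of_le_pi (by linarith) h1 (by simpa) (by simpa using this.le) h

theorem differentiableAt_stieltjesNum {p : ℝ} (hp0 : 0 < p) (hp1 : p < 1) {a : ℝ} (ha : 0 ≤ a)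
    (l : ℝ) {w : ℂ} (h0 : 0 ≤ w.im) (h1 : w.im ≤ Real.pi) :
    DifferentiableAt ℂ (stieltjesNum a p l) w := by
  unfold stieltjesNum
  have := add_exp_ne_zero hp0 hp1 ha h0 h1
  fun_prop (disch := assumption)

theorem continuousAt_dslope {f : ℂ → ℂ} {c w : ℂ} (hc : DifferentiableAt ℂ f c)
    (hw : ContinuousAt f w) : ContinuousAt (dslope f c) w := by
  by_cases h : w = c
  · rw [h]
    exact continuousAt_dslope_same.2 hc
  · exact (continuousAt_dslope_of_ne h).2 hw

theorem continuousAt_stieltjesFun {p : ℝ} (hp0 : 0 < p) (hp1 : p < 1) {a : ℝ} (ha : 0 ≤ a)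
    (l : ℝ) {w : ℂ} (h0 : 0 ≤ w.im) (h1 : w.im ≤ Real.pi) :
    ContinuousAt (stieltjesFun a p l) w := by
  refine ContinuousAt.mul (ContinuousAt.div ?_ ?_ (dslope_exp_ne_zero l h0 h1))
    Complex.continuous_exp.continuousAt
  · exact continuousAt_dslope
      (differentiableAt_stieltjesNum hp0 hp1 ha l (by simp) (by simpa using Real.pi_pos.le))
      (differentiableAt_stieltjesNum hp0 hp1 ha l h0 h1).continuousAt
  · exact continuousAt_dslope Complex.differentiableAt_exp Complex.continuous_exp.continuousAt

theorem differentiableAt_stieltjesFun {p : ℝ} (hp0 : 0 < p) (hp1 : p < 1) {a : ℝ} (ha : 0 ≤ a)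
    (l : ℝ) {w : ℂ} (h0 : 0 < w.im) (h1 : w.im ≤ Real.pi) :
    DifferentiableAt ℂ (stieltjesFun a p l) w := by
  have hw : w ≠ l := by
    rintro rfl
    simp at h0
  refine DifferentiableAt.mul (DifferentiableAt.div ?_ ?_ (dslope_exp_ne_zero l h0.le h1))
    Complex.differentiableAt_exp
  · exact (differentiableAt_dslope_of_ne hw).2
      (differentiableAt_stieltjesNum hp0 hp1 ha l h0.le h1)
  · exact (differentiableAt_dslope_of_ne hw).2 Complex.differentiableAt_exp

theorem im_stieltjesFun_ofReal {a : ℝ} (ha : 0 ≤ a) (p : ℝ) {l x : ℝ} (hx : x ≠ l) :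
    (stieltjesFun a p l x).im = 0 := by
  rw [stieltjesFun_of_ne ha p (by exact_mod_cast hx)]
  have : stieltjesNum a p l x * (Complex.exp x / (Complex.exp x - Real.exp l)) =
      (((1 / (a + Real.exp (p * x)) -
      Real.exp (l / 2) / (a + Real.exp (p * l)) * Real.exp (-x / 2)) *
      (Real.exp x / (Real.exp x - Real.exp l)) : ℝ) : ℂ) := by
    simp [stieltjesNum]
  rw [this, Complex.ofReal_im]

theorem norm_stieltjesFun_le {p : ℝ} (hp0 : 0 < p) (hp1 : p < 1) {a : ℝ} (ha : 0 ≤ a)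
    {l : ℝ} {w : ℂ} (h0 : 0 ≤ w.im) (h1 : w.im ≤ Real.pi) (hw : w.re ≠ l) :
    ‖stieltjesFun a p l w‖ ≤
      (Real.exp (-(p * w.re)) / Real.sin (p * Real.pi) +
        Real.exp (l / 2) / (a + Real.exp (p * l)) * Real.exp (-w.re / 2)) *
      (Real.exp w.re / |Real.exp w.re - Real.exp l|) := by
  have hs := sin_mul_pi_pos hp0 hp1
  have hne : Real.exp w.re - Real.exp l ≠ 0 := sub_ne_zero.2 fun h => hw (Real.exp_injective h)
  rw [stieltjesFun_of_ne ha p (by rintro rfl; simp at hw), norm_mul, norm_div, Complex.norm_exp]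
  have hne' := abs_pos.2 hne
  gcongr ?_ * (_ / ?_)
  · refine (norm_sub_le _ _).trans (add_le_add ?_ (le_of_eq ?_))
    · rw [norm_div, norm_one, Real.exp_neg, inv_eq_one_div, div_div,
        mul_comm (Real.exp _) (Real.sin _)]
      gcongr
      exact sin_mul_exp_le_norm_add_exp hp0 hp1 ha h0 h1
    · rw [norm_mul, Complex.norm_real, Complex.norm_exp, Real.norm_of_nonneg (by positivity)]
      simp
  · have h := abs_norm_sub_norm_le (Complex.exp w) (Real.exp l : ℂ)
    rwa [Complex.norm_exp, Complex.norm_real, Real.norm_of_nonneg (Real.exp_pos l).le] at h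

theorem tendsto_stieltjesBound_atTop {p : ℝ} (hp0 : 0 < p) (l s c : ℝ) :
    Tendsto (fun x : ℝ => (Real.exp (-(p * x)) / s + c * Real.exp (-x / 2)) *
      (Real.exp x / |Real.exp x - Real.exp l|)) atTop (𝓝 0) := by
  have h1 : Tendsto (fun x : ℝ => Real.exp (-(p * x))) atTop (𝓝 0) :=
    Real.tendsto_exp_neg_atTop_nhds_zero.comp (tendsto_id.const_mul_atTop hp0)
  have h2 : Tendsto (fun x : ℝ => Real.exp (-x / 2)) atTop (𝓝 0) := by
    refine (Real.tendsto_exp_neg_atTop_nhds_zero.comp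
      (tendsto_id.atTop_div_const two_pos)).congr fun x => ?_
    simp [neg_div]
  have h3 : Tendsto (fun x : ℝ => 1 / |1 - Real.exp l * Real.exp (-x)|) atTop
      (𝓝 (1 / |1 - Real.exp l * 0|)) :=
    tendsto_const_nhds.div (tendsto_const_nhds.sub
      (Real.tendsto_exp_neg_atTop_nhds_zero.const_mul _)).abs (by simp)
  have h4 := ((h1.div_const s).add (h2.const_mul c)).mul h3
  simp only [zero_div, mul_zero, add_zero, zero_mul] at h4
  refine h4.congr fun x => ?_
  congr 1
  have : Real.exp x - Real.exp l = Real.exp x * (1 - Real.exp l * Real.exp (-x)) := by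
    rw [Real.exp_neg]
    field_simp
  rw [this, abs_mul, abs_of_pos (Real.exp_pos x), ← div_div, div_self (Real.exp_pos x).ne']

/-- The factor `e ^ x` turns the growing exponentials into `e ^ ((1 - p) x)` and `e ^ (x / 2)`. -/
theorem tendsto_stieltjesBound_atBot {p : ℝ} (hp1 : p < 1) (l s c : ℝ) :
    Tendsto (fun x : ℝ => (Real.exp (-(p * x)) / s + c * Real.exp (-x / 2)) *
      (Real.exp x / |Real.exp x - Real.exp l|)) atBot (𝓝 0) := by
  have h1 : Tendsto (fun x : ℝ => Real.exp ((1 - p) * x)) atBot (𝓝 0) :=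
    Real.tendsto_exp_atBot.comp (tendsto_id.const_mul_atBot (by linarith))
  have h2 : Tendsto (fun x : ℝ => Real.exp (x / 2)) atBot (𝓝 0) :=
    Real.tendsto_exp_atBot.comp (tendsto_id.atBot_div_const two_pos)
  have h3 : Tendsto (fun x : ℝ => 1 / |Real.exp x - Real.exp l|) atBot
      (𝓝 (1 / |0 - Real.exp l|)) :=
    tendsto_const_nhds.div (Real.tendsto_exp_atBot.sub tendsto_const_nhds).abs
      (by simp)
  have h4 := ((h1.div_const s).add (h2.const_mul c)).mul h3
  simp only [zero_div, mul_zero, add_zero, zero_mul] at h4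
  refine h4.congr fun x => ?_
  rw [show (1 - p) * x = -(p * x) + x by ring, show x / 2 = -x / 2 + x by ring, Real.exp_add,
    Real.exp_add]
  ring

theorem tendsto_integral_vertical_of_norm_le {g : ℂ → ℂ} {B : ℝ → ℝ} {f : Filter ℝ} {l : ℝ}
    (hf : ∀ᶠ x in f, x ≠ l) (hB : Tendsto B f (𝓝 0))
    (hg : ∀ w : ℂ, 0 ≤ w.im → w.im ≤ Real.pi → w.re ≠ l → ‖g w‖ ≤ B w.re) :
    Tendsto (fun x : ℝ => ∫ y : ℝ in (0 : ℝ)..Real.pi, g (x + y * Complex.I)) f (𝓝 0) := by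
  have h : Tendsto (fun x => B x * |Real.pi - 0|) f (𝓝 0) := by
    simpa using hB.mul_const |Real.pi - 0|
  refine squeeze_zero_norm' ?_ h
  filter_upwards [hf] with x hx
  refine intervalIntegral.norm_integral_le_of_norm_le_const fun y hy => ?_
  rw [Set.uIoc_of_le Real.pi_pos.le] at hy
  have := hg (x + y * Complex.I) (by simpa using hy.1.le) (by simpa using hy.2) (by simpa using hx)
  simpa using this

theorem tendsto_integral_im_stieltjesFun {p : ℝ} (hp0 : 0 < p) (hp1 : p < 1) {a : ℝ}
    (ha : 0 ≤ a) (l : ℝ) :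
    Tendsto (fun R : ℝ => ∫ x in (-R)..R, (stieltjesFun a p l (x + Real.pi * Complex.I)).im)
      atTop (𝓝 0) := by
  have hpi := Real.pi_pos
  have hbd := fun w h0 h1 hw => norm_stieltjesFun_le hp0 hp1 ha (l := l) (w := w) h0 h1 hw
  have hT := tendsto_integral_vertical_of_norm_le (g := stieltjesFun a p l)
    (eventually_ne_atTop l) (tendsto_stieltjesBound_atTop hp0 l _ _) hbd
  have hB := (tendsto_integral_vertical_of_norm_le (g := stieltjesFun a p l)
    (eventually_ne_atBot l) (tendsto_stieltjesBound_atBot hp1 l _ _) hbd).comp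
    tendsto_neg_atTop_atBot
  have hlim : Tendsto (fun R : ℝ =>
      (Complex.I • (∫ y : ℝ in (0 : ℝ)..Real.pi, stieltjesFun a p l (R + y * Complex.I)) -
        Complex.I • (∫ y : ℝ in (0 : ℝ)..Real.pi,
          stieltjesFun a p l ((-R : ℝ) + y * Complex.I))).im) atTop (𝓝 0) := by
    have := (hT.const_smul Complex.I).sub (hB.const_smul Complex.I)
    simpa [Function.comp_def] using (Complex.continuous_im.tendsto _).comp this
  refine hlim.congr fun R => ?_
  have hrect := Complex.integral_boundary_rect_eq_zero_of_continuousOn_of_differentiableOn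
    (stieltjesFun a p l) (-R : ℝ) (R + Real.pi * Complex.I) ?_ ?_
  · simp only [Complex.ofReal_re, Complex.ofReal_im, Complex.add_re, Complex.add_im,
      Complex.mul_re, Complex.mul_im, Complex.I_re, Complex.I_im, mul_zero, mul_one, zero_mul,
      sub_zero, add_zero, zero_add, Complex.ofReal_zero] at hrect
    have hbot : (∫ x : ℝ in (-R)..R, stieltjesFun a p l x).im = 0 := by
      have : ∫ x : ℝ in (-R)..R, stieltjesFun a p l x =
          ∫ x : ℝ in (-R)..R, (((stieltjesFun a p l x).re : ℝ) : ℂ) := by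
        -- The removed singularity `x = l` is a null set.
        refine intervalIntegral.integral_congr_ae ?_
        filter_upwards [Measure.ae_ne volume l] with x hx _
        exact Complex.ext (by simp) (by simpa using im_stieltjesFun_ofReal ha p hx)
      rw [this, intervalIntegral.integral_ofReal, Complex.ofReal_im]
    have htop : (∫ x : ℝ in (-R)..R, stieltjesFun a p l (x + Real.pi * Complex.I)).im =
        ∫ x : ℝ in (-R)..R, (stieltjesFun a p l (x + Real.pi * Complex.I)).im := by
      have hint : IntervalIntegrable
          (fun x : ℝ => stieltjesFun a p l (x + Real.pi * Complex.I)) volume (-R) R := by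
        refine Continuous.intervalIntegrable (continuous_iff_continuousAt.2 fun x => ?_) _ _
        refine ContinuousAt.comp (f := fun x : ℝ => (x + Real.pi * Complex.I : ℂ))
          (continuousAt_stieltjesFun hp0 hp1 ha l ?_ ?_) (by fun_prop)
        · simpa using hpi.le
        · simp
      exact (Complex.imCLM.intervalIntegral_comp_comm hint).symm
    have h := congrArg Complex.im hrect
    rw [← htop]
    simp only [Complex.add_im, Complex.sub_im, Complex.zero_im] at h ⊢
    linarith
  · intro w hw
    have h2 := hw.2
    simp [Set.uIcc_of_le hpi.le] at h2
    exact (continuousAt_stieltjesFun hp0 hp1 ha l h2.1 h2.2).continuousWithinAt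
  · intro w hw
    have h2 := hw.2
    simp [hpi.le] at h2
    exact (differentiableAt_stieltjesFun hp0 hp1 ha l h2.1 h2.2.le).differentiableWithinAt

/-! ### Evaluation for `n = 0`. -/

theorem integral_rpow_neg_half_mul_inv {b : ℝ} (hb : 0 < b) :
    ∫ t in Set.Ioi (0 : ℝ), t ^ (-(1 / 2) : ℝ) * (1 / (b + t) ^ (0 + 1)) =
      Real.pi / √b := by
  have hsb : 0 < √b := Real.sqrt_pos.2 hb
  have h := integral_Ioi_of_hasDerivAt_of_nonneg (a := 0) (l := 2 / √b * (Real.pi / 2))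
    (g := fun t : ℝ => 2 / √b * Real.arctan (√t / √b))
    (g' := fun t : ℝ => t ^ (-(1 / 2) : ℝ) * (1 / (b + t) ^ (0 + 1))) ?_ ?_ ?_ ?_
  · rw [h]
    simp
  · exact Continuous.continuousWithinAt (by fun_prop)
  · intro t ht
    have ht0 : 0 < t := ht
    have hst : 0 < √t := Real.sqrt_pos.2 ht0
    have h1 := (((Real.hasDerivAt_sqrt ht0.ne').div_const (√b)).arctan).const_mul (2 / √b)
    refine h1.congr_deriv ?_
    have h2 := Real.sq_sqrt hb.le
    have h3 := Real.sq_sqrt ht0.le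
    rw [Real.rpow_neg ht0.le, ← Real.sqrt_eq_rpow, div_pow, h2, h3]
    field_simp
    rw [h2]
    ring
  · intro t ht
    have ht0 : 0 < t := ht
    positivity
  · refine Tendsto.const_mul _ ((tendsto_nhds_of_tendsto_nhdsWithin
      Real.tendsto_arctan_atTop).comp ?_)
    exact Real.tendsto_sqrt_atTop.atTop_div_const hsb

/-- On `Im w = π` one has `e ^ w = -e ^ x`, so the Cauchy kernel is real and `e ^ (-w / 2)` is
purely imaginary. The factor `|e ^ x|` is the Jacobian of `t = e ^ x`. -/
theorem im_stieltjesFun_add_pi_mul_I {a : ℝ} (ha : 0 ≤ a) (p l x : ℝ) :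
    (stieltjesFun a p l (x + Real.pi * Complex.I)).im = |Real.exp x| •
      (Real.exp (l / 2) / (a + Real.exp (p * l)) *
        (Real.exp x ^ (-(1 / 2) : ℝ) * (1 / (Real.exp l + Real.exp x) ^ (0 + 1))) -
      Real.sin (p * Real.pi) * catalanIntegrand 0 a (Real.exp l) p (Real.exp x)) := by
  have hpi := Real.pi_pos
  have hne : (x + Real.pi * Complex.I : ℂ) ≠ l := fun h => by
    have := congrArg Complex.im h
    simp [hpi.ne'] at this
  set c := Real.exp (l / 2) / (a + Real.exp (p * l)) with hc
  have hratio : Complex.exp (x + Real.pi * Complex.I) /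
      (Complex.exp (x + Real.pi * Complex.I) - Real.exp l) =
      ((Real.exp x / (Real.exp l + Real.exp x) : ℝ) : ℂ) := by
    rw [Complex.exp_add, Complex.exp_pi_mul_I]
    push_cast
    rw [mul_neg_one, ← neg_add', neg_div_neg_eq, add_comm (Complex.exp x)]
  have hhalf : Complex.exp (-(x + Real.pi * Complex.I) / 2) =
      (Real.exp (-x / 2) : ℂ) * -Complex.I := by
    rw [show -(x + Real.pi * Complex.I) / 2 = -x / 2 + -(Real.pi / 2 * Complex.I) by ring,
      Complex.exp_add, Complex.exp_neg (_ * _), Complex.exp_pi_div_two_mul_I, Complex.inv_I]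
    push_cast
    rfl
  have hinv : (1 / ((a : ℂ) + Complex.exp (p * (x + Real.pi * Complex.I)))).im =
      -(Real.exp (p * x) * Real.sin (p * Real.pi)) /
        (a ^ 2 + 2 * a * Real.cos (p * Real.pi) * Real.exp (p * x) + Real.exp (p * x) ^ 2) := by
    rw [one_div, Complex.inv_im, Complex.normSq_apply]
    simp only [Complex.add_re, Complex.add_im, Complex.ofReal_re, Complex.ofReal_im,
      Complex.exp_re, Complex.exp_im, Complex.re_ofReal_mul, Complex.im_ofReal_mul,
      Complex.I_re, Complex.I_im, mul_zero, mul_one, zero_add, add_zero]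
    congr 1
    linear_combination Real.exp (p * x) ^ 2 * Real.sin_sq_add_cos_sq (p * Real.pi)
  rw [stieltjesFun_of_ne ha p hne, hratio, Complex.im_mul_ofReal, stieltjesNum, Complex.sub_im,
    hinv, hhalf, ← hc, ← mul_assoc, ← Complex.ofReal_mul, Complex.im_ofReal_mul, catalanIntegrand,
    rpow_two_mul_eq_sq (Real.exp_pos x), ← Real.exp_mul, ← Real.exp_mul, abs_of_pos (Real.exp_pos x),
    mul_comm x p, show x * -(1 / 2) = -x / 2 by ring]
  simp only [Complex.neg_im, Complex.I_im, smul_eq_mul]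
  ring

theorem catalanFunctional_zero_eq {p : ℝ} (hp0 : 0 < p) (hp1 : p < 1) {a b : ℝ} (ha : 0 ≤ a)
    (hb : 0 < b) : catalanFunctional 0 a b p = 1 / (a + b ^ p) := by
  obtain ⟨l, rfl⟩ : ∃ l, Real.exp l = b := ⟨Real.log b, Real.exp_log hb⟩
  set c := Real.exp (l / 2) / (a + Real.exp (p * l)) with hc
  set F : ℝ → ℝ := fun t => c * (t ^ (-(1 / 2) : ℝ) * (1 / (Real.exp l + t) ^ (0 + 1))) -
    Real.sin (p * Real.pi) * catalanIntegrand 0 a (Real.exp l) p t with hF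
  have hi1 := (integrableOn_rpow_neg_mul_inv_pow (p := 1 / 2) (by norm_num) (by norm_num) 0
    hb).const_mul c
  have hi2 := (integrableOn_catalanIntegrand hp0 hp1 0 a hb).const_mul (Real.sin (p * Real.pi))
  have hFint : IntegrableOn F (Set.Ioi 0) := hi1.sub hi2
  have himg : Real.exp '' Set.univ = Set.Ioi 0 := by rw [Set.image_univ, Real.range_exp]
  have hderiv : ∀ x ∈ Set.univ, HasDerivWithinAt Real.exp (Real.exp x) Set.univ x :=
    fun x _ => (Real.hasDerivAt_exp x).hasDerivWithinAt
  have hint : Integrable fun x => |Real.exp x| • F (Real.exp x) := by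
    rw [← integrableOn_univ]
    rw [← himg] at hFint
    exact (integrableOn_image_iff_integrableOn_abs_deriv_smul MeasurableSet.univ hderiv
      Real.exp_injective.injOn F).1 hFint
  have hval : ∫ t in Set.Ioi 0, F t = ∫ x, |Real.exp x| • F (Real.exp x) := by
    rw [← himg, integral_image_eq_integral_abs_deriv_smul MeasurableSet.univ hderiv
      Real.exp_injective.injOn F, setIntegral_univ]
  have hlim := intervalIntegral_tendsto_integral hint tendsto_neg_atTop_atBot tendsto_id
  have hlim2 := tendsto_integral_im_stieltjesFun hp0 hp1 ha l
  simp only [im_stieltjesFun_add_pi_mul_I ha] at hlim2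
  have hzero : ∫ t in Set.Ioi 0, F t = 0 := hval.trans (tendsto_nhds_unique hlim hlim2)
  rw [hF, integral_sub hi1 hi2, integral_const_mul, integral_const_mul,
    integral_rpow_neg_half_mul_inv hb, sub_eq_zero] at hzero
  rw [catalanFunctional, div_mul_eq_mul_div, ← hzero, hc, Real.sqrt_eq_rpow, ← Real.exp_mul,
    ← Real.exp_mul, mul_comm l p, mul_one_div]
  have h1 : a + Real.exp (p * l) ≠ 0 := by positivity
  have := Real.pi_pos.ne'
  field_simp

/-! ### From `n = 0` to all `n` by differentiation in `b`. -/

theorem factorial_mul_catalanFunctional_eq {p : ℝ} (hp0 : 0 < p) (hp1 : p < 1) (a : ℝ)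
    {U : Set ℝ} (hU : IsOpen U) (hU0 : U ⊆ Set.Ioi 0) (F : ℕ → ℝ → ℝ)
    (h0 : ∀ b ∈ U, catalanFunctional 0 a b p = F 0 b)
    (hF : ∀ n, ∀ b ∈ U, HasDerivAt (F n) (-F (n + 1) b) b) (n : ℕ) :
    ∀ b ∈ U, (n.factorial : ℝ) * catalanFunctional n a b p = F n b := by
  induction n with
  | zero => simpa using h0
  | succ n ih =>
    intro b hb
    have h1 := (hasDerivAt_catalanFunctional hp0 hp1 n a (hU0 hb)).const_mul (n.factorial : ℝ)
    have h2 := h1.congr_of_eventuallyEq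
      (f₁ := F n) (by filter_upwards [hU.mem_nhds hb] with x hx using (ih x hx).symm)
    have h3 := h2.unique (hF n b hb)
    rw [Nat.factorial_succ]
    push_cast
    linear_combination -h3

theorem risingFactorial_zero (x : ℝ) : risingFactorial x 0 = 1 := by simp [risingFactorial]

theorem risingFactorial_succ (x : ℝ) (n : ℕ) :
    risingFactorial x (n + 1) = risingFactorial x n * (x + n) :=
  ascPochhammer_succ_eval n x

theorem risingFactorial_zero_left {n : ℕ} (hn : 1 ≤ n) : risingFactorial 0 n = 0 := by
  have : n ≠ 0 := by omega
  simp [risingFactorial, this]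

/-- The separate bound `m` keeps the base fixed during the induction on `n`. -/
theorem abs_risingFactorial_le (x : ℝ) {n m : ℕ} (hnm : n ≤ m) :
    |risingFactorial x n| ≤ (|x| + m) ^ n := by
  induction n with
  | zero => simp [risingFactorial_zero]
  | succ n ih =>
    rw [risingFactorial_succ, abs_mul, pow_succ]
    have h1 : (n : ℝ) ≤ m := by exact_mod_cast (Nat.le_succ n).trans hnm
    have h2 : |x + n| ≤ |x| + m := by
      refine (abs_add_le _ _).trans ?_
      rw [Nat.abs_cast]
      linarith
    exact mul_le_mul (ih (by omega)) h2 (abs_nonneg _) (by positivity)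

theorem summable_add_one_pow_mul_geometric (n : ℕ) {r : ℝ} (hr0 : 0 < r) (hr1 : r < 1) :
    Summable fun k : ℕ => ((k : ℝ) + 1) ^ n * r ^ k := by
  have h := summable_pow_mul_geometric_of_norm_lt_one n
    (by rwa [Real.norm_of_nonneg hr0.le] : ‖r‖ < 1)
  have h2 := ((summable_nat_add_iff 1).2 h).mul_left r⁻¹
  refine h2.congr fun k => ?_
  push_cast
  rw [pow_succ]
  field_simp

theorem abs_risingFactorial_neg_mul_le (q : ℝ) (n k : ℕ) :
    |risingFactorial (-(q * k)) n| ≤ (|q| + n) ^ n * ((k : ℝ) + 1) ^ n := by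
  refine (abs_risingFactorial_le _ le_rfl).trans ?_
  rw [← mul_pow, abs_neg, abs_mul, Nat.abs_cast]
  gcongr
  have := abs_nonneg q
  have h1 : (0 : ℝ) ≤ k := k.cast_nonneg
  have h2 : (0 : ℝ) ≤ n := n.cast_nonneg
  nlinarith [mul_nonneg h1 h2]

theorem rpow_mul_natCast_sub_natCast {b : ℝ} (hb : 0 < b) (q : ℝ) (k n : ℕ) :
    b ^ (q * k - n) = (b ^ q) ^ k * (b ^ n)⁻¹ := by
  rw [Real.rpow_sub hb, Real.rpow_mul hb.le, Real.rpow_natCast, Real.rpow_natCast, div_eq_mul_inv]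

/-- The `n`-th derivative (up to the sign `(-1) ^ n`) of `y ^ k * b ^ (q * k)` in `b`. -/
noncomputable def powerTerm (q y : ℝ) (n k : ℕ) (b : ℝ) : ℝ :=
  risingFactorial (-(q * k)) n * (y ^ k * b ^ (q * k - n))

theorem powerTerm_eq {b : ℝ} (hb : 0 < b) (q y : ℝ) (n k : ℕ) :
    powerTerm q y n k b = risingFactorial (-(q * k)) n * (y * b ^ q) ^ k * (b ^ n)⁻¹ := by
  rw [powerTerm, rpow_mul_natCast_sub_natCast hb, mul_pow]
  ring

theorem hasDerivAt_powerTerm (q y : ℝ) (n k : ℕ) {b : ℝ} (hb : 0 < b) :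
    HasDerivAt (powerTerm q y n k) (-powerTerm q y (n + 1) k b) b := by
  have h := ((Real.hasDerivAt_rpow_const (p := q * k - n) (Or.inl hb.ne')).const_mul
    (y ^ k)).const_mul (risingFactorial (-(q * k)) n)
  refine h.congr_deriv ?_
  rw [powerTerm, risingFactorial_succ]
  push_cast
  rw [sub_sub]
  ring

theorem abs_powerTerm_le (q y : ℝ) (n k : ℕ) {b l r : ℝ} (hl : 0 < l) (hlb : l ≤ b)
    (hr : |y * b ^ q| ≤ r) :
    |powerTerm q y n k b| ≤ (|q| + n) ^ n * (l ^ n)⁻¹ * (((k : ℝ) + 1) ^ n * r ^ k) := by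
  have hb : 0 < b := hl.trans_le hlb
  rw [powerTerm_eq hb, abs_mul, abs_mul, abs_pow, abs_of_pos (by positivity : 0 < (b ^ n)⁻¹)]
  calc _ ≤ (|q| + n) ^ n * ((k : ℝ) + 1) ^ n * r ^ k * (l ^ n)⁻¹ := by
        have := (abs_nonneg _).trans hr
        gcongr
        exact abs_risingFactorial_neg_mul_le q n k
    _ = _ := by ring

theorem summable_powerTerm (q y : ℝ) (n : ℕ) {b : ℝ} (hb : 0 < b) (hy : |y * b ^ q| < 1) :
    Summable fun k => powerTerm q y n k b := by
  obtain ⟨r, hr, hr1⟩ := exists_between hy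
  refine Summable.of_norm_bounded ((summable_add_one_pow_mul_geometric n
    ((abs_nonneg _).trans_lt hr) hr1).mul_left ((|q| + n) ^ n * (b ^ n)⁻¹)) fun k => ?_
  exact abs_powerTerm_le q y n k hb le_rfl hr.le

theorem continuousAt_abs_mul_rpow (q y : ℝ) {b : ℝ} (hb : 0 < b) :
    ContinuousAt (fun x : ℝ => |y * x ^ q|) b :=
  (continuousAt_const.mul (Real.continuousAt_rpow_const b q (Or.inl hb.ne'))).abs

theorem hasDerivAt_tsum_powerTerm (q y : ℝ) (n : ℕ) {b : ℝ} (hb : 0 < b) (hy : |y * b ^ q| < 1) :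
    HasDerivAt (fun x => ∑' k, powerTerm q y n k x) (-∑' k, powerTerm q y (n + 1) k b) b := by
  obtain ⟨r, hr, hr1⟩ := exists_between hy
  -- Near `b` the ratio stays below a fixed `r < 1` and `x` away from `0`, giving one summable
  -- majorant for the differentiated terms.
  have hev : ∀ᶠ x in 𝓝 b, b / 2 < x ∧ |y * x ^ q| < r :=
    (eventually_gt_nhds (half_lt_self hb)).and ((continuousAt_abs_mul_rpow q y hb).eventually
      (Iio_mem_nhds hr))
  obtain ⟨ε, hε, hball⟩ := Metric.eventually_nhds_iff_ball.1 hev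
  rw [← tsum_neg]
  refine hasDerivAt_tsum_of_isPreconnected (t := Metric.ball b ε) (y₀ := b)
    ((summable_add_one_pow_mul_geometric (n + 1) ((abs_nonneg _).trans_lt hr) hr1).mul_left
      ((|q| + (n + 1 : ℕ)) ^ (n + 1) * ((b / 2) ^ (n + 1))⁻¹))
    Metric.isOpen_ball (convex_ball b ε).isPreconnected
    (fun k x hx => hasDerivAt_powerTerm q y n k ((half_pos hb).trans (hball x hx).1))
    (fun k x hx => ?_) (Metric.mem_ball_self hε) (summable_powerTerm q y n hb hy)
    (Metric.mem_ball_self hε)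
  rw [norm_neg]
  exact abs_powerTerm_le q y (n + 1) k (half_pos hb) (hball x hx).1.le (hball x hx).2.le

theorem isOpen_setOf_abs_mul_rpow_lt_one (q y : ℝ) :
    IsOpen {b : ℝ | 0 < b ∧ |y * b ^ q| < 1} := by
  refine isOpen_iff_mem_nhds.2 fun b hb => ?_
  exact (eventually_gt_nhds hb.1).and ((continuousAt_abs_mul_rpow q y hb.1).eventually
    (Iio_mem_nhds hb.2))

/-- If `𝔆_0(a, b; p)` is a geometric series up to a constant, `𝔆_n` is given by the
differentiated series. -/
theorem factorial_mul_catalanFunctional_eq_tsum {p : ℝ} (hp0 : 0 < p) (hp1 : p < 1)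
    (a q y K c : ℝ)
    (h0 : ∀ b, 0 < b → |y * b ^ q| < 1 →
      catalanFunctional 0 a b p = K * (∑' k, powerTerm q y 0 k b) + c)
    (n : ℕ) {b : ℝ} (hb : 0 < b) (hy : |y * b ^ q| < 1) :
    (n.factorial : ℝ) * catalanFunctional n a b p =
      K * (∑' k, powerTerm q y n k b) + if n = 0 then c else 0 := by
  refine factorial_mul_catalanFunctional_eq hp0 hp1 a (isOpen_setOf_abs_mul_rpow_lt_one q y)
    (fun b hb => hb.1)
    (fun n b => K * (∑' k, powerTerm q y n k b) + if n = 0 then c else 0)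
    (fun b hb => by simpa using h0 b hb.1 hb.2) (fun n b hb => ?_) n b ⟨hb, hy⟩
  have h := ((hasDerivAt_tsum_powerTerm q y n hb.1 hb.2).const_mul K).add_const
    (if n = 0 then c else 0)
  refine h.congr_deriv ?_
  simp

theorem tsum_powerTerm_zero (q y : ℝ) {b : ℝ} (hb : 0 < b) (hy : |y * b ^ q| < 1) :
    ∑' k, powerTerm q y 0 k b = (1 - y * b ^ q)⁻¹ := by
  rw [← tsum_geometric_of_abs_lt_one hy]
  refine tsum_congr fun k => ?_
  rw [powerTerm_eq hb, risingFactorial_zero]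
  simp

theorem catalanFunctional_zero_left {p : ℝ} (hp0 : 0 < p) (hp1 : p < 1) (n : ℕ) {b : ℝ}
    (hb : 0 < b) :
    catalanFunctional n 0 b p =
      risingFactorial p n / ((n.factorial : ℝ) * b ^ ((n : ℝ) + p)) := by
  have h := factorial_mul_catalanFunctional_eq hp0 hp1 0 isOpen_Ioi subset_rfl
    -- For `a = 0` the function `b ^ (-p)` is the single term `k = 1` with `q = -p`, `y = 1`.
    (fun n => powerTerm (-p) 1 n 1) (fun b hb => ?_)
    (fun n b hb => hasDerivAt_powerTerm (-p) 1 n 1 hb) n b hb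
  · have hn : (n.factorial : ℝ) ≠ 0 := by positivity
    rw [mul_comm, ← eq_div_iff hn] at h
    rw [h, powerTerm, Nat.cast_one, mul_one, neg_neg, one_pow, one_mul,
      show -p - n = -((n : ℝ) + p) by ring, Real.rpow_neg hb.le]
    field_simp
  · have hb : 0 < b := hb
    rw [catalanFunctional_zero_eq hp0 hp1 le_rfl hb, powerTerm, risingFactorial_zero]
    simp [Real.rpow_neg hb.le]

/-! ### The two series expansions and the main theorem. -/

theorem upperTerm_eq_mul_powerTerm (n : ℕ) (a p : ℝ) {b : ℝ} (hb : 0 < b) (k : ℕ) :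
    upperTerm n a b p k = b ^ n * powerTerm p (-(1 / a)) n k b := by
  rw [powerTerm_eq hb, upperTerm, show -(b ^ p / a) = -(1 / a) * b ^ p by ring]
  field_simp

theorem lowerTerm_eq_mul_powerTerm (n : ℕ) (a p : ℝ) {b : ℝ} (hb : 0 < b) (k : ℕ) :
    lowerTerm n a b p k = b ^ n * powerTerm (-p) (-a) n k b := by
  have h : (-(b ^ p / a))⁻¹ = -a * b ^ (-p) := by
    rw [Real.rpow_neg hb.le, inv_neg, inv_div]
    ring
  rw [powerTerm_eq hb, lowerTerm, zpow_neg, zpow_natCast, ← inv_pow, h, neg_mul p, neg_neg]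
  field_simp

theorem abs_neg_one_div_mul_rpow (a b p : ℝ) : |-(1 / a) * b ^ p| = |b ^ p / a| := by
  rw [show -(1 / a) * b ^ p = -(b ^ p / a) by ring, abs_neg]

theorem abs_neg_mul_rpow_neg (a p : ℝ) {b : ℝ} (hb : 0 < b) :
    |-a * b ^ (-p)| = |b ^ p / a|⁻¹ := by
  rw [Real.rpow_neg hb.le, ← abs_inv, inv_div, neg_mul, abs_neg, div_eq_mul_inv]

theorem catalanFunctional_eq_tsum_upperTerm {p : ℝ} (hp0 : 0 < p) (hp1 : p < 1) (n : ℕ) {a b : ℝ}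
    (ha : 0 < a) (hb : 0 < b) (hab : |b ^ p / a| < 1) :
    Summable (upperTerm n a b p) ∧
      catalanFunctional n a b p =
        1 / (a * b ^ n * (n.factorial : ℝ)) * ∑' k : ℕ, upperTerm n a b p k := by
  rw [← abs_neg_one_div_mul_rpow] at hab
  have hterm : upperTerm n a b p = fun k => b ^ n * powerTerm p (-(1 / a)) n k b :=
    funext fun k => upperTerm_eq_mul_powerTerm n a p hb k
  rw [hterm]
  refine ⟨(summable_powerTerm p _ n hb hab).mul_left _, ?_⟩
  have h := factorial_mul_catalanFunctional_eq_tsum hp0 hp1 a p (-(1 / a)) (1 / a) 0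
    (fun b hb hy => ?_) n hb hab
  · have hn : (n.factorial : ℝ) ≠ 0 := by positivity
    rw [ite_self, add_zero, mul_comm, ← eq_div_iff hn] at h
    rw [h, tsum_mul_left]
    field_simp
  · have := Real.rpow_pos_of_pos hb p
    rw [catalanFunctional_zero_eq hp0 hp1 ha.le hb, tsum_powerTerm_zero p _ hb hy, add_zero,
      ← one_div, one_div_mul_one_div]
    congr 1
    field_simp
    ring

/-- Here `1 / (a + b ^ p) = 1 / a - (1 / a) / (1 + a b ^ (-p))`; differentiation kills the constant
`1 / a`, which survives only for `n = 0`. -/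
theorem catalanFunctional_eq_tsum_lowerTerm {p : ℝ} (hp0 : 0 < p) (hp1 : p < 1) (n : ℕ) {a b : ℝ}
    (ha : 0 < a) (hb : 0 < b) (hab : 1 < |b ^ p / a|) :
    Summable (lowerTerm n a b p) ∧
      catalanFunctional n a b p =
        -(1 / (a * b ^ n * (n.factorial : ℝ))) * (∑' k : ℕ, lowerTerm n a b p k) +
          if n = 0 then 1 / a else 0 := by
  have hab' : |-a * b ^ (-p)| < 1 := by
    rw [abs_neg_mul_rpow_neg a p hb]
    exact inv_lt_one_of_one_lt₀ hab
  have hterm : lowerTerm n a b p = fun k => b ^ n * powerTerm (-p) (-a) n k b :=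
    funext fun k => lowerTerm_eq_mul_powerTerm n a p hb k
  rw [hterm]
  refine ⟨(summable_powerTerm (-p) _ n hb hab').mul_left _, ?_⟩
  have h := factorial_mul_catalanFunctional_eq_tsum hp0 hp1 a (-p) (-a) (-(1 / a)) (1 / a)
    (fun b hb hy => ?_) n hb hab'
  · have hn : (n.factorial : ℝ) ≠ 0 := by positivity
    rw [mul_comm, ← eq_div_iff hn] at h
    rw [h, tsum_mul_left, add_div]
    congr 1
    · field_simp
    · split_ifs with h0
      · simp [h0]
      · simp
  · have := Real.rpow_pos_of_pos hb p
    rw [catalanFunctional_zero_eq hp0 hp1 ha.le hb, tsum_powerTerm_zero (-p) _ hb hy,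
      Real.rpow_neg hb.le]
    have h1 : 1 - -a * (b ^ p)⁻¹ = (b ^ p + a) / b ^ p := by
      field_simp
      ring
    rw [h1, inv_div]
    field_simp
    ring

theorem lowerTerm_zero (n : ℕ) (a b p : ℝ) :
    lowerTerm n a b p 0 = if n = 0 then 1 else 0 := by
  split_ifs with h
  · simp [lowerTerm, h, risingFactorial_zero]
  · simp [lowerTerm, risingFactorial_zero_left (Nat.one_le_iff_ne_zero.2 h)]

theorem catalanFunctional_eq_tsum_lowerTerm_add_one {p : ℝ} (hp0 : 0 < p) (hp1 : p < 1) (n : ℕ)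
    {a b : ℝ} (ha : 0 < a) (hb : 0 < b) (hab : 1 < |b ^ p / a|) :
    Summable (fun k : ℕ => lowerTerm n a b p (k + 1)) ∧
      catalanFunctional n a b p =
        -(1 / (a * b ^ n * (n.factorial : ℝ))) * ∑' k : ℕ, lowerTerm n a b p (k + 1) := by
  obtain ⟨hs, h⟩ := catalanFunctional_eq_tsum_lowerTerm hp0 hp1 n ha hb hab
  refine ⟨(summable_nat_add_iff 1).2 hs, ?_⟩
  rw [h, hs.tsum_eq_zero_add, lowerTerm_zero]
  -- For `n = 0` the term `k = 0` contributes `-1 / a`, cancelling the constant; for `n ≥ 1` both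
  -- vanish.
  split_ifs with h0
  · subst h0
    simp
    ring
  · ring

theorem mainTheorem2 (p : ℝ) (hp0 : 0 < p) (hp1 : p < 1) (n : ℕ) :
    -- the defining integral converges
    (∀ a b : ℝ, 0 ≤ a → 0 < b →
      IntegrableOn (catalanIntegrand n a b p) (Set.Ioi 0)) ∧
    -- upper signs
    (∀ a b : ℝ, 0 < a → 0 < b → |b ^ p / a| < 1 →
      Summable (upperTerm n a b p) ∧
      catalanFunctional n a b p =
        1 / (a * b ^ n * (n.factorial : ℝ)) * ∑' k : ℕ, upperTerm n a b p k) ∧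
    -- lower signs, summation from `k = 0`, for `n ≥ 1`
    (∀ a b : ℝ, 0 < a → 0 < b → 1 < |b ^ p / a| → 1 ≤ n →
      Summable (lowerTerm n a b p) ∧
      catalanFunctional n a b p =
        -(1 / (a * b ^ n * (n.factorial : ℝ))) * ∑' k : ℕ, lowerTerm n a b p k) ∧
    -- lower signs, the term `k = 0` omitted, for every `n ≥ 0`
    (∀ a b : ℝ, 0 < a → 0 < b → 1 < |b ^ p / a| →
      Summable (fun k : ℕ => lowerTerm n a b p (k + 1)) ∧
      catalanFunctional n a b p =
        -(1 / (a * b ^ n * (n.factorial : ℝ))) * ∑' k : ℕ, lowerTerm n a b p (k + 1)) ∧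
    -- `a = 0`: the lower formula after cancelling the factor `1 / a`
    (∀ b : ℝ, 0 < b →
      catalanFunctional n 0 b p =
        risingFactorial p n / ((n.factorial : ℝ) * b ^ ((n : ℝ) + p))) ∧
    -- the boundary case `a = b ^ p` is the limit of both formulas
    (∀ b : ℝ, 0 < b →
      Tendsto
        (fun q : ℝ × ℝ =>
          1 / (q.1 * q.2 ^ n * (n.factorial : ℝ)) * ∑' k : ℕ, upperTerm n q.1 q.2 p k)
        (𝓝[{q : ℝ × ℝ | 0 < q.1 ∧ 0 < q.2 ∧ |q.2 ^ p / q.1| < 1}] (b ^ p, b))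
        (𝓝 (catalanFunctional n (b ^ p) b p)) ∧
      Tendsto
        (fun q : ℝ × ℝ =>
          -(1 / (q.1 * q.2 ^ n * (n.factorial : ℝ))) *
            ∑' k : ℕ, lowerTerm n q.1 q.2 p (k + 1))
        (𝓝[{q : ℝ × ℝ | 0 < q.1 ∧ 0 < q.2 ∧ 1 < |q.2 ^ p / q.1|}] (b ^ p, b))
        (𝓝 (catalanFunctional n (b ^ p) b p))) ∧
    -- `n = 0`
    (∀ a b : ℝ, 0 ≤ a → 0 < b → catalanFunctional 0 a b p = 1 / (a + b ^ p)) ∧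
    (∀ b : ℝ, 0 < b → catalanFunctional 0 (b ^ p) b p = 1 / (2 * b ^ p)) := by
  refine ⟨fun a b _ hb => integrableOn_catalanIntegrand hp0 hp1 n a hb,
    fun a b ha hb hab => catalanFunctional_eq_tsum_upperTerm hp0 hp1 n ha hb hab,
    fun a b ha hb hab hn => ?_,
    fun a b ha hb hab => catalanFunctional_eq_tsum_lowerTerm_add_one hp0 hp1 n ha hb hab,
    fun b hb => catalanFunctional_zero_left hp0 hp1 n hb, fun b hb => ⟨?_, ?_⟩,
    fun a b ha hb => catalanFunctional_zero_eq hp0 hp1 ha hb, fun b hb => ?_⟩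
  · have h := catalanFunctional_eq_tsum_lowerTerm hp0 hp1 n ha hb hab
    rwa [if_neg (Nat.one_le_iff_ne_zero.1 hn), add_zero] at h
  · refine ((continuousAt_catalanFunctional hp0 hp1 n (b ^ p) hb).continuousWithinAt).congr' ?_
    filter_upwards [self_mem_nhdsWithin] with q hq
    exact (catalanFunctional_eq_tsum_upperTerm hp0 hp1 n hq.1 hq.2.1 hq.2.2).2
  · refine ((continuousAt_catalanFunctional hp0 hp1 n (b ^ p) hb).continuousWithinAt).congr' ?_
    filter_upwards [self_mem_nhdsWithin] with q hq
    exact (catalanFunctional_eq_tsum_lowerTerm_add_one hp0 hp1 n hq.1 hq.2.1 hq.2.2).2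
  · rw [catalanFunctional_zero_eq hp0 hp1 (Real.rpow_nonneg hb.le p) hb, two_mul]
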